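/- Let $a,b,c,x,y$ be five distinct elements. A polymatroid on a finite set $E$ is a real-valued function $f$ on the subsets of $E$ with $f(\emptyset)=0$ that is non-negative, monotone and submodular. For $I,J,K\subseteq E$ write $f(I,J|K)=f(I\cup K)+f(J\cup K)-f(I\cup J\cup K)-f(K)$ and $f(I,J)=f(I,J|\emptyset)$; braces and union signs are omitted, so that $ac$ denotes $\{a,c\}$. Let $f_x$ and $f_y$ be polymatroids on $abcx$ and $abcy$, respectively, with the same restriction to $abc$. They are called adhesive if there is a polymatroid $f$ on $abcxy$ that extends both $f_x$ and $f_y$ and satisfies $f(x,y|abc)=0$. Then $f_x$ and $f_y$ are adhesive if and only if the inequalities $$f_x(a,x|c)+f_x(a,b|x)+f_y(a,b|y)+f_y(c,y)+s+t\;\ge\; f_x(a,b)$$ hold for all (four) choices of $s\in\{f_x(b,x|ac),\,f_y(b,y|ac)\}$ and $t\in\{f_x(c,x|ab),\,f_y(c,y|ab)\}$, together with all inequalities obtained from these by permuting $a,b,c$ arbitrarily and/or by interchanging $x$ and $y$ (and with them $f_x$ and $f_y$). -/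

import Mathlib

/-- `f` is the rank function of a polymatroid on the finite ground set `E`: normalized
(`f ∅ = 0`), non-negative, monotone and submodular on the subsets of `E`.
The values of `f` at sets that are not contained in `E` are irrelevant. -/
structure IsPolymatroidOn {α : Type*} [DecidableEq α] (E : Finset α) (f : Finset α → ℝ) :
    Prop where
  map_empty : f ∅ = 0
  nonneg : ∀ A, A ⊆ E → 0 ≤ f A
  mono : ∀ A B, A ⊆ B → B ⊆ E → f A ≤ f B
  submodular : ∀ A B, A ⊆ E → B ⊆ E → f (A ∪ B) + f (A ∩ B) ≤ f A + f B

/-- The expression `f(I,J|K) = f(IK) + f(JK) - f(IJK) - f(K)`. -/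
def condInfo {α : Type*} [DecidableEq α] (f : Finset α → ℝ) (I J K : Finset α) : ℝ :=
  f (I ∪ K) + f (J ∪ K) - f (I ∪ J ∪ K) - f K

/-- The expression `f(I,J) = f(I,J|∅)`. -/
def mutInfo {α : Type*} [DecidableEq α] (f : Finset α → ℝ) (I J : Finset α) : ℝ :=
  condInfo f I J ∅

/-- For disjoint `M`, `X`, `Y`: the polymatroids `fX` on `M ∪ X` and `fY` on `M ∪ Y` are adhesive,
that is, some polymatroid on `M ∪ X ∪ Y` extends both and makes `X` and `Y` independent
over `M`. -/
def Adhesive {α : Type*} [DecidableEq α] (M X Y : Finset α) (fX fY : Finset α → ℝ) : Prop :=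
  ∃ f : Finset α → ℝ, IsPolymatroidOn (M ∪ X ∪ Y) f ∧
    (∀ A, A ⊆ M ∪ X → f A = fX A) ∧ (∀ A, A ⊆ M ∪ Y → f A = fY A) ∧
    condInfo f X Y M = 0

/-- The four inequalities (one for each choice of the terms `s` and `t`)
`fx(a,x|c) + fx(a,b|x) + fy(a,b|y) + fy(c,y) + s + t ≥ fx(a,b)`,
where `s` is `fx(b,x|ac)` or `fy(b,y|ac)`, and `t` is `fx(c,x|ab)` or `fy(c,y|ab)`. -/
def AdhesiveIneq {α : Type*} [DecidableEq α] (fx fy : Finset α → ℝ) (a b c x y : α) : Prop :=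
  ∀ s ∈ ({condInfo fx {b} {x} {a, c}, condInfo fy {b} {y} {a, c}} : Set ℝ),
  ∀ t ∈ ({condInfo fx {c} {x} {a, b}, condInfo fy {c} {y} {a, b}} : Set ℝ),
    condInfo fx {a} {x} {c} + condInfo fx {a} {b} {x} + condInfo fy {a} {b} {y}
      + mutInfo fy {c} {y} + s + t ≥ mutInfo fx {a} {b}

/-!
Write `M = {a, b, c}`. The values of a common extension `f` with `f(x,y|M) = 0` are prescribed
except at the sets `xyK` with `K` a proper subset of `M`, so the problem is to find the function
`g K = f (xyK)` on the subsets of `M`. A normalized set function is a polymatroid once it satisfies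
the elementary inequalities (`isPolymatroidOn_of_elementary`). Those that involve `g` say that `g`
is submodular, that it does not decrease in the last step up to `M`, where its value `T = p M` is
prescribed, that `g K ≤ p K` with `p K = fx(xK) + fy(yK) - fx(K)`, and that
`g (iK) - g K ≤ u i K`, where `u i K` is the smaller one of the increments of `fx` and `fy` at
`xK` and `yK`. Such a `g` is called a filling, and `adhesive_iff_exists_isFilling` states the
reduction to fillings, for an arbitrary set `M`.

A filling of the cube of subsets of `{a, b, c}` satisfies
`(T - u b {a,c}) + (T - u c {a,b}) ≤ g(ac) + g(ab) ≤ u a {c} + g(c) + g(ab)`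
`≤ u a {c} + u c ∅ + g(∅) + g(ab) ≤ u a {c} + u c ∅ + p(a) + p(b)` (`IsFilling.key`).
Conversely, these inequalities, for all orders of `a, b, c`, suffice
(`exists_isFilling_of_key`). One takes the least possible values at the pairs. At the singletons the
upper bounds work, unless one of them is too large for the other two to admit a value at `∅`; it is
then lowered as far as needed (`exists_between_of_le_add`). At `∅` the least value permitted by the
increments is taken.

Finally, unfolding the minima in `u` turns the inequality into those of `AdhesiveIneq`, up to
cases which hold for all polymatroids (`adhesiveIneq_and_iff`).
-/

/-! ### Polymatroids and elementary inequalities -/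

section Elementary

variable {α : Type*} [DecidableEq α]

theorem IsPolymatroidOn.submodular_insert {E : Finset α} {f : Finset α → ℝ}
    (hf : IsPolymatroidOn E f) {i j : α} {K : Finset α} (hi : i ∈ E) (hj : j ∈ E) (hK : K ⊆ E)
    (hij : i ≠ j) (hiK : i ∉ K) :
    f (insert i (insert j K)) + f K ≤ f (insert i K) + f (insert j K) := by
  have h := hf.submodular (insert i K) (insert j K) (Finset.insert_subset hi hK)
    (Finset.insert_subset hj hK)
  have h1 : insert i K ∪ insert j K = insert i (insert j K) := by grind
  have h2 : insert i K ∩ insert j K = K := by grind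
  rwa [h1, h2] at h

/-- A normalized set function is a polymatroid as soon as it satisfies the elementary
inequalities: monotonicity at the top and submodularity on the squares
`K, iK, jK, ijK` of the subset lattice. -/
theorem isPolymatroidOn_of_elementary {E : Finset α} {f : Finset α → ℝ} (h0 : f ∅ = 0)
    (htop : ∀ i ∈ E, f (E.erase i) ≤ f E)
    (hsub : ∀ i ∈ E, ∀ j ∈ E, ∀ K ⊆ E, i ≠ j → i ∉ K → j ∉ K →
      f (insert i (insert j K)) + f K ≤ f (insert i K) + f (insert j K)) :
    IsPolymatroidOn E f := by
  -- The increment of `f` at `i` is antitone in the set to which `i` is added.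
  have hincr : ∀ i ∈ E, ∀ A D : Finset α, A ∪ D ⊆ E → i ∉ A ∪ D →
      f (insert i (A ∪ D)) - f (A ∪ D) ≤ f (insert i A) - f A := by
    intro i hi A D
    induction D using Finset.induction_on with
    | empty => simp
    | insert j D hj ih =>
      intro hE hni
      rw [Finset.union_insert] at hE hni ⊢
      have hE' : A ∪ D ⊆ E := (Finset.subset_insert _ _).trans hE
      have h1 := ih hE' (fun h => hni (Finset.mem_insert_of_mem h))
      by_cases hjA : j ∈ A ∪ D
      · rwa [Finset.insert_eq_of_mem hjA]
      · have h2 := hsub i hi j (hE (Finset.mem_insert_self _ _)) (A ∪ D) hE'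
          (fun h => hni (h ▸ Finset.mem_insert_self _ _))
          (fun h => hni (Finset.mem_insert_of_mem h)) hjA
        linarith
  have hmono1 : ∀ i ∈ E, ∀ A ⊆ E, i ∉ A → f A ≤ f (insert i A) := by
    intro i hi A hA hiA
    have h := hincr i hi A (E.erase i) (by grind) (by grind)
    have h1 : A ∪ E.erase i = E.erase i := by grind
    rw [h1, Finset.insert_erase hi] at h
    linarith [htop i hi]
  have hmono : ∀ A D : Finset α, A ∪ D ⊆ E → f A ≤ f (A ∪ D) := by
    intro A D
    induction D using Finset.induction_on with
    | empty => simp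
    | insert j D hj ih =>
      intro hE
      rw [Finset.union_insert] at hE ⊢
      have hE' : A ∪ D ⊆ E := (Finset.subset_insert _ _).trans hE
      by_cases hjA : j ∈ A ∪ D
      · rw [Finset.insert_eq_of_mem hjA]; exact ih hE'
      · exact (ih hE').trans (hmono1 j (hE (Finset.mem_insert_self _ _)) _ hE' hjA)
  have hmono' : ∀ A B, A ⊆ B → B ⊆ E → f A ≤ f B := by
    intro A B hAB hB
    have h := hmono A B
    rw [Finset.union_eq_right.2 hAB] at h
    exact h hB
  -- Adding the elements of `D` one by one increases `f` less on `C ∪ B` than on `C`.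
  have hsubm : ∀ C B D : Finset α, C ∪ B ∪ D ⊆ E → Disjoint D (C ∪ B) →
      f (C ∪ B ∪ D) - f (C ∪ B) ≤ f (C ∪ D) - f C := by
    intro C B D
    induction D using Finset.induction_on with
    | empty => simp
    | insert j D hj ih =>
      intro hE hd
      have h1 := ih (by grind) (by grind [Finset.disjoint_left])
      have hjn : j ∉ C ∪ B := by grind [Finset.disjoint_left]
      have h2 := hincr j (by grind) (C ∪ D) B (by grind) (by grind)
      have e : C ∪ D ∪ B = C ∪ B ∪ D := by grind
      rw [e] at h2
      rw [Finset.union_insert, Finset.union_insert]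
      linarith
  refine ⟨h0, fun A hA => h0 ▸ hmono' ∅ A (Finset.empty_subset A) hA, hmono', ?_⟩
  intro A B hA hB
  have h := hsubm (A ∩ B) B (A \ B) (by grind) (by grind [Finset.disjoint_left])
  have e1 : A ∩ B ∪ B = B := by grind
  have e2 : B ∪ A \ B = A ∪ B := by grind
  have e3 : A ∩ B ∪ A \ B = A := by grind
  rw [e1, e2, e3] at h
  linarith

end Elementary

/-! ### Fillings -/

section Filling

variable {α : Type*} [DecidableEq α]

/-- A *filling* of the subset lattice of `M` for the bounds `p` and `u`: a submodular function `g`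
below `p`, equal to `p` at `M`, which does not decrease in the last step up to `M` and whose
increment from `K` to `iK` is at most `u i K`. For a common extension `f` of polymatroids on `Mx`
and `My`, the function `g K = f (xyK)` is such a filling. -/
structure IsFilling (M : Finset α) (p : Finset α → ℝ) (u : α → Finset α → ℝ)
    (g : Finset α → ℝ) : Prop where
  top : g M = p M
  le : ∀ K ⊆ M, g K ≤ p K
  incr : ∀ K ⊆ M, ∀ i ∈ M, i ∉ K → g (insert i K) ≤ g K + u i K
  submodular : ∀ K ⊆ M, ∀ i ∈ M, ∀ j ∈ M, i ≠ j → i ∉ K → j ∉ K →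
    g (insert i (insert j K)) + g K ≤ g (insert i K) + g (insert j K)
  mono : ∀ i ∈ M, g (M.erase i) ≤ g M

/-- The largest value at `xyK` permitted by `f(x,y|K) ≥ 0`. -/
def jointBound (fx fy : Finset α → ℝ) (x y : α) (K : Finset α) : ℝ :=
  fx (insert x K) + fy (insert y K) - fx K

/-- The largest increment from `xyK` to `ixyK` permitted by `f(i,y|xK) ≥ 0` and
`f(i,x|yK) ≥ 0`. -/
def incrBound (fx fy : Finset α → ℝ) (x y i : α) (K : Finset α) : ℝ :=
  min (fx (insert x (insert i K)) - fx (insert x K)) (fy (insert y (insert i K)) - fy (insert y K))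

/-- The function equal to `g K` at `xyK`, to `fy` at the other sets containing `y`, and to `fx`
at the sets that do not contain `y`. -/
def amalgam (fx fy g : Finset α → ℝ) (x y : α) (A : Finset α) : ℝ :=
  if y ∈ A then if x ∈ A then g ((A.erase x).erase y) else fy A else fx A

theorem Adhesive.exists_isFilling {M : Finset α} {x y : α} {fx fy : Finset α → ℝ} (hxM : x ∉ M)
    (hyM : y ∉ M) (hxy : x ≠ y) (h : Adhesive M {x} {y} fx fy) :
    ∃ g, IsFilling M (jointBound fx fy x y) (incrBound fx fy x y) g := by
  obtain ⟨f, hf, hfx, hfy, h0⟩ := h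
  have ex : ∀ K ⊆ M, f (insert x K) = fx (insert x K) := fun K hK => hfx _ (by grind)
  have ey : ∀ K ⊆ M, f (insert y K) = fy (insert y K) := fun K hK => hfy _ (by grind)
  have e : ∀ K ⊆ M, f K = fx K := fun K hK => hfx _ (by grind)
  refine ⟨fun K => f (insert x (insert y K)), ?_, ?_, ?_, ?_, ?_⟩
  · have e1 : ({x} ∪ {y} ∪ M : Finset α) = insert x (insert y M) := by grind
    rw [condInfo, e1, ← Finset.insert_eq, ← Finset.insert_eq] at h0
    have := ex M subset_rfl
    have := ey M subset_rfl
    have := e M subset_rfl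
    simp only [jointBound]
    linarith
  · intro K hK
    have := hf.submodular_insert (i := x) (j := y) (K := K) (by grind) (by grind) (by grind) hxy
      (by grind)
    rw [ex K hK, ey K hK, e K hK] at this
    simp only [jointBound]
    linarith
  · intro K hK i hi hiK
    have h1 := hf.submodular_insert (i := i) (j := y) (K := insert x K) (by grind) (by grind)
      (by grind) (by grind) (by grind)
    have h2 := hf.submodular_insert (i := i) (j := x) (K := insert y K) (by grind) (by grind)
      (by grind) (by grind) (by grind)
    have hiK' : insert i K ⊆ M := Finset.insert_subset hi hK
    rw [Finset.insert_comm y x, Finset.insert_comm i x, Finset.insert_comm i y,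
      Finset.insert_comm i x, ex K hK, ex _ hiK'] at h1
    rw [Finset.insert_comm i x, Finset.insert_comm i y, ey K hK, ey _ hiK'] at h2
    simp only [incrBound]
    rw [← sub_le_iff_le_add', le_min_iff]
    constructor <;> linarith
  · intro K hK i hi j hj hij hiK hjK
    have := hf.submodular_insert (i := i) (j := j) (K := insert x (insert y K)) (by grind)
      (by grind) (by grind) hij (by grind)
    simpa only [Finset.insert_comm j x, Finset.insert_comm i x, Finset.insert_comm j y,
      Finset.insert_comm i y] using this
  · intro i hi
    exact hf.mono _ _ (by grind) (by grind)

theorem IsPolymatroidOn.submodular_adjoin {M : Finset α} {x : α} {f : Finset α → ℝ}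
    (hf : IsPolymatroidOn (M ∪ {x}) f) (hxM : x ∉ M) {K : Finset α} (hK : K ⊆ M) {i : α}
    (hi : i ∈ M) : f (insert x (insert i K)) + f K ≤ f (insert x K) + f (insert i K) :=
  hf.submodular_insert (by grind) (by grind) (by grind) (by grind) (by grind)

theorem IsPolymatroidOn.submodular_insert_adjoin {M : Finset α} {x : α} {f : Finset α → ℝ}
    (hf : IsPolymatroidOn (M ∪ {x}) f) (hxM : x ∉ M) {K : Finset α} (hK : K ⊆ M) {i j : α}
    (hi : i ∈ M) (hj : j ∈ M) (hij : i ≠ j) (hiK : i ∉ K) :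
    f (insert x (insert i (insert j K))) + f (insert x K)
      ≤ f (insert x (insert i K)) + f (insert x (insert j K)) := by
  have h := hf.submodular_insert (i := i) (j := j) (K := insert x K) (by grind) (by grind)
    (by grind) (by grind) (by grind)
  rwa [Finset.insert_comm j, Finset.insert_comm i x, Finset.insert_comm i x] at h

theorem exists_subset_eq_insert_pair {M K : Finset α} {x y : α} (hK : K ⊆ M ∪ {x} ∪ {y}) :
    ∃ L ⊆ M, K = L ∨ K = insert x L ∨ K = insert y L ∨ K = insert x (insert y L) := by
  refine ⟨(K.erase x).erase y, by grind, ?_⟩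
  by_cases h1 : x ∈ K <;> by_cases h2 : y ∈ K
  · right; right; right; grind
  · right; left; grind
  · right; right; left; grind
  · left; grind

/-- Only the submodular inequalities with `x` and `y` both in play have to be checked: the others
are those of `fx` and `fy`. -/
theorem IsFilling.isPolymatroidOn_amalgam {M : Finset α} {x y : α} {fx fy g : Finset α → ℝ}
    (hxM : x ∉ M) (hyM : y ∉ M) (hxy : x ≠ y)
    (hfx : IsPolymatroidOn (M ∪ {x}) fx) (hfy : IsPolymatroidOn (M ∪ {y}) fy)
    (hcommon : ∀ A, A ⊆ M → fx A = fy A)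
    (hg : IsFilling M (jointBound fx fy x y) (incrBound fx fy x y) g) :
    IsPolymatroidOn (M ∪ {x} ∪ {y}) (amalgam fx fy g x y) := by
  set f := amalgam fx fy g x y with hf
  -- The set-theoretic side goals below are closed by `grind` in a cleared context, as it would
  -- otherwise instantiate the inequalities over all subsets of `M`.
  have eg : ∀ K ⊆ M, f (insert x (insert y K)) = g K := by
    intro K hK
    have h1 : ((insert x (insert y K)).erase x).erase y = K := by grind
    have h2 : y ∈ insert x (insert y K) := by simp
    have h3 : x ∈ insert x (insert y K) := by simp
    simp only [hf, amalgam, if_pos h2, if_pos h3, h1]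
  have ex : ∀ K ⊆ M, f (insert x K) = fx (insert x K) := by
    intro K hK
    have : y ∉ insert x K := by clear * - hyM hxy hK; grind
    simp only [hf, amalgam, if_neg this]
  have ey : ∀ K ⊆ M, f (insert y K) = fy (insert y K) := by
    intro K hK
    have : x ∉ insert y K := by clear * - hxM hxy hK; grind
    simp only [hf, amalgam, if_neg this, if_pos (Finset.mem_insert_self y K)]
  have e : ∀ K ⊆ M, f K = fx K := by
    intro K hK
    have : y ∉ K := fun h => hyM (hK h)
    simp only [hf, amalgam, if_neg this]
  have key_xy : ∀ K ⊆ M,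
      f (insert x (insert y K)) + f K ≤ f (insert x K) + f (insert y K) := by
    intro K hK
    have := hg.le K hK
    rw [eg K hK, ex K hK, ey K hK, e K hK]
    simp only [jointBound] at this
    linarith
  -- The increment at `i` decreases when `x` or `y` is added to the set.
  have key_incr : ∀ K ⊆ M, ∀ i ∈ M, i ∉ K →
      (f (insert x (insert i K)) + f K ≤ f (insert x K) + f (insert i K) ∧
      f (insert y (insert i K)) + f K ≤ f (insert y K) + f (insert i K)) ∧
      f (insert x (insert y (insert i K))) + f (insert y K)
        ≤ f (insert x (insert y K)) + f (insert y (insert i K)) ∧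
      f (insert x (insert y (insert i K))) + f (insert x K)
        ≤ f (insert x (insert y K)) + f (insert x (insert i K)) := by
    intro K hK i hi hiK
    have hiK' : insert i K ⊆ M := Finset.insert_subset hi hK
    rw [eg K hK, eg _ hiK', ex K hK, ex _ hiK', ey K hK, ey _ hiK', e K hK, e _ hiK']
    have h1 := hg.incr K hK i hi hiK
    rw [incrBound, ← sub_le_iff_le_add', le_min_iff] at h1
    have h2 := hfx.submodular_adjoin hxM hK hi
    have h3 := hfy.submodular_adjoin hyM hK hi
    rw [← hcommon _ hK, ← hcommon _ hiK'] at h3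
    refine ⟨⟨?_, ?_⟩, ?_, ?_⟩ <;> linarith [h1.1, h1.2]
  -- Submodularity at two elements of `M`, over a set containing neither, one or both of `x`, `y`.
  have key_sub : ∀ K ⊆ M, ∀ i ∈ M, ∀ j ∈ M, i ≠ j → i ∉ K → j ∉ K →
      (f (insert i (insert j K)) + f K ≤ f (insert i K) + f (insert j K) ∧
      f (insert x (insert i (insert j K))) + f (insert x K)
        ≤ f (insert x (insert i K)) + f (insert x (insert j K))) ∧
      f (insert y (insert i (insert j K))) + f (insert y K)
        ≤ f (insert y (insert i K)) + f (insert y (insert j K)) ∧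
      f (insert x (insert y (insert i (insert j K)))) + f (insert x (insert y K))
        ≤ f (insert x (insert y (insert i K))) + f (insert x (insert y (insert j K))) := by
    intro K hK i hi j hj hij hiK hjK
    have hiK' : insert i K ⊆ M := Finset.insert_subset hi hK
    have hjK' : insert j K ⊆ M := Finset.insert_subset hj hK
    have hijK' : insert i (insert j K) ⊆ M := Finset.insert_subset hi hjK'
    rw [e _ hK, e _ hiK', e _ hjK', e _ hijK', ex _ hK, ex _ hiK', ex _ hjK', ex _ hijK',
      ey _ hK, ey _ hiK', ey _ hjK', ey _ hijK', eg _ hK, eg _ hiK', eg _ hjK', eg _ hijK']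
    have h1 := hfx.submodular_insert (Finset.mem_union_left _ hi) (Finset.mem_union_left _ hj)
      (hK.trans Finset.subset_union_left) hij hiK
    have h2 := hfx.submodular_insert_adjoin hxM hK hi hj hij hiK
    have h3 := hfy.submodular_insert_adjoin hyM hK hi hj hij hiK
    exact ⟨⟨h1, h2⟩, h3, hg.submodular K hK i hi j hj hij hiK hjK⟩
  refine isPolymatroidOn_of_elementary ?_ ?_ ?_
  · rw [e ∅ (Finset.empty_subset _), hfx.map_empty]
  · have hE : M ∪ {x} ∪ {y} = insert x (insert y M) := by clear * -; grind
    rw [hE, eg M subset_rfl]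
    have htop := hg.top
    simp only [jointBound] at htop
    have hM := hcommon M subset_rfl
    intro i hi
    rcases Finset.mem_insert.1 hi with rfl | hi
    · rw [Finset.erase_insert (by clear * - hxM hxy; grind), ey M subset_rfl, htop]
      linarith [hfx.mono M (insert i M) (Finset.subset_insert _ _) (by clear * -; grind)]
    rcases Finset.mem_insert.1 hi with rfl | hi
    · rw [Finset.insert_comm, Finset.erase_insert (by clear * - hyM hxy; grind), ex M subset_rfl,
        htop]
      linarith [hfy.mono M (insert i M) (Finset.subset_insert _ _) (by clear * -; grind)]
    · have : (insert x (insert y M)).erase i = insert x (insert y (M.erase i)) := by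
        clear * - hxM hyM hi
        grind
      rw [this, eg _ (Finset.erase_subset _ _)]
      exact hg.mono i hi
  · have key_x : ∀ i ∈ M ∪ {y}, ∀ K ⊆ M ∪ {x} ∪ {y}, i ∉ K → x ∉ K →
        f (insert x (insert i K)) + f K ≤ f (insert x K) + f (insert i K) := by
      intro i hi K hK hiK hxK
      obtain ⟨L, hL, rfl | rfl | rfl | rfl⟩ := exists_subset_eq_insert_pair hK
      · rcases Finset.mem_union.1 hi with hi | hi
        · exact (key_incr _ hL i hi hiK).1.1
        · rw [Finset.mem_singleton.1 hi]
          exact key_xy _ hL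
      · simp at hxK
      · have hiM : i ∈ M := by clear * - hi hiK; grind
        rw [Finset.insert_comm i]
        exact (key_incr _ hL i hiM fun h => hiK (Finset.mem_insert_of_mem h)).2.1
      · simp at hxK
    have key_y : ∀ i ∈ M, ∀ K ⊆ M ∪ {x} ∪ {y}, i ∉ K → y ∉ K →
        f (insert y (insert i K)) + f K ≤ f (insert y K) + f (insert i K) := by
      intro i hi K hK hiK hyK
      obtain ⟨L, hL, rfl | rfl | rfl | rfl⟩ := exists_subset_eq_insert_pair hK
      · exact (key_incr _ hL i hi hiK).1.2
      · rw [Finset.insert_comm i x, Finset.insert_comm y x, Finset.insert_comm y x]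
        exact (key_incr _ hL i hi fun h => hiK (Finset.mem_insert_of_mem h)).2.2
      · simp at hyK
      · simp at hyK
    intro i hi j hj K hK hij hiK hjK
    by_cases hix : i = x
    · subst hix
      exact key_x j (by clear * - hj hij; grind) K hK hjK hiK
    by_cases hjx : j = x
    · subst hjx
      rw [Finset.insert_comm, add_comm (f (insert i K))]
      exact key_x i (by clear * - hi hix; grind) K hK hiK hjK
    have hi' : i ∈ M ∪ {y} := by clear * - hi hix; grind
    have hj' : j ∈ M ∪ {y} := by clear * - hj hjx; grind
    by_cases hiy : i = y
    · subst hiy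
      exact key_y j (by clear * - hj' hij; grind) K hK hjK hiK
    have hiM : i ∈ M := by clear * - hi' hiy; grind
    by_cases hjy : j = y
    · subst hjy
      rw [Finset.insert_comm, add_comm (f (insert i K))]
      exact key_y i hiM K hK hiK hjK
    have hjM : j ∈ M := by clear * - hj' hjy; grind
    obtain ⟨L, hL, h⟩ := exists_subset_eq_insert_pair hK
    obtain ⟨⟨h1, h2⟩, h3, h4⟩ := key_sub L hL i hiM j hjM hij
      (by clear * - h hiK; grind) (by clear * - h hjK; grind)
    rcases h with rfl | rfl | rfl | rfl
    · exact h1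
    · simpa only [Finset.insert_comm j x, Finset.insert_comm i x] using h2
    · simpa only [Finset.insert_comm j y, Finset.insert_comm i y] using h3
    · simpa only [Finset.insert_comm j x, Finset.insert_comm i x, Finset.insert_comm j y,
        Finset.insert_comm i y] using h4

theorem adhesive_iff_exists_isFilling {M : Finset α} {x y : α} {fx fy : Finset α → ℝ}
    (hxM : x ∉ M) (hyM : y ∉ M) (hxy : x ≠ y)
    (hfx : IsPolymatroidOn (M ∪ {x}) fx) (hfy : IsPolymatroidOn (M ∪ {y}) fy)
    (hcommon : ∀ A, A ⊆ M → fx A = fy A) :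
    Adhesive M {x} {y} fx fy ↔
      ∃ g, IsFilling M (jointBound fx fy x y) (incrBound fx fy x y) g := by
  refine ⟨Adhesive.exists_isFilling hxM hyM hxy, fun ⟨g, hg⟩ => ?_⟩
  refine ⟨amalgam fx fy g x y, hg.isPolymatroidOn_amalgam hxM hyM hxy hfx hfy hcommon, ?_, ?_, ?_⟩
  · intro A hA
    have : y ∉ A := by grind
    simp [amalgam, this]
  · intro A hA
    have hx : x ∉ A := by grind
    by_cases hy : y ∈ A
    · simp [amalgam, hx, hy]
    · simpa [amalgam, hx, hy] using hcommon A (by grind)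
  · have h1 : ((insert x (insert y M)).erase x).erase y = M := by grind
    have h2 : ({x} ∪ {y} ∪ M : Finset α) = insert x (insert y M) := by grind
    have h3 : y ∉ insert x M := by grind
    have h4 : x ∉ insert y M := by grind
    have htop := hg.top
    simp only [jointBound] at htop
    rw [condInfo, h2, ← Finset.insert_eq, ← Finset.insert_eq]
    simp only [amalgam, h3, h4, hyM, h1, Finset.mem_insert_self, Finset.mem_insert, or_true,
      if_true, if_false, htop]
    ring

end Filling

/-! ### Fillings of the three-dimensional cube -/

section Cube

/-- Three numbers can be chosen between lower and upper bounds so that each is at most the sum of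
the other two plus a constant. They are the upper bounds, except that the upper bound which
violates its constraint is lowered to meet it; `h₂a`, `h₂b`, `h₂c` show that no two constraints are
violated at once, and that the lowering respects the other two constraints. -/
theorem exists_between_of_le_add {La Lb Lc Ua Ub Uc wa wb wc : ℝ}
    (ha : La ≤ Ua) (hb : Lb ≤ Ub) (hc : Lc ≤ Uc)
    (h₂a : 0 ≤ 2 * La + wb + wc) (h₂b : 0 ≤ 2 * Lb + wa + wc) (h₂c : 0 ≤ 2 * Lc + wa + wb)
    (h₁a : La ≤ Ub + Uc + wa) (h₁b : Lb ≤ Ua + Uc + wb) (h₁c : Lc ≤ Ua + Ub + wc) :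
    ∃ va vb vc : ℝ, La ≤ va ∧ va ≤ Ua ∧ Lb ≤ vb ∧ vb ≤ Ub ∧ Lc ≤ vc ∧ vc ≤ Uc ∧
      va ≤ vb + vc + wa ∧ vb ≤ va + vc + wb ∧ vc ≤ va + vb + wc := by
  by_cases hva : Ua ≤ Ub + Uc + wa
  · by_cases hvb : Ub ≤ Ua + Uc + wb
    · by_cases hvc : Uc ≤ Ua + Ub + wc
      · exact ⟨Ua, Ub, Uc, ha, le_rfl, hb, le_rfl, hc, le_rfl, hva, hvb, hvc⟩
      · refine ⟨Ua, Ub, Ua + Ub + wc, ha, le_rfl, hb, le_rfl, h₁c, ?_, ?_, ?_, le_rfl⟩ <;> linarith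
    · refine ⟨Ua, Ua + Uc + wb, Uc, ha, le_rfl, h₁b, ?_, hc, le_rfl, ?_, le_rfl, ?_⟩ <;> linarith
  · refine ⟨Ub + Uc + wa, Ub, Uc, h₁a, ?_, hb, le_rfl, hc, le_rfl, le_rfl, ?_, ?_⟩ <;> linarith

variable {α : Type*} [DecidableEq α]

theorem subset_triple_cases {a b c : α} {K : Finset α} (hK : K ⊆ {a, b, c}) :
    K = ∅ ∨ K = {a} ∨ K = {b} ∨ K = {c} ∨ K = {a, b} ∨ K = {a, c} ∨ K = {b, c} ∨
      K = {a, b, c} := by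
  by_cases ha : a ∈ K <;> by_cases hb : b ∈ K <;> by_cases hc : c ∈ K
  · have : K = {a, b, c} := by grind
    simp [this]
  · have : K = {a, b} := by grind
    simp [this]
  · have : K = {a, c} := by grind
    simp [this]
  · have : K = {a} := by grind
    simp [this]
  · have : K = {b, c} := by grind
    simp [this]
  · have : K = {b} := by grind
    simp [this]
  · have : K = {c} := by grind
    simp [this]
  · have : K = ∅ := by grind
    simp [this]

set_option maxHeartbeats 1000000 in
/-- A filling over `{a, b, c}` exists as soon as the inequality `hkey` holds for all orders of
`a, b, c`. With `T = p {a, b, c}`, the values `T - u a {b, c}`, `T - u b {a, c}`, `T - u c {a, b}` at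
the pairs are the least possible ones, which is the best choice: the other constraints, as far as
they involve the pairs and are not implied by `hp` and `hu`, bound these values from above. -/
theorem exists_isFilling_of_key {a b c : α} (hab : a ≠ b) (hac : a ≠ c) (hbc : b ≠ c)
    {p : Finset α → ℝ} {u : α → Finset α → ℝ}
    (hp : ∀ K ⊆ {a, b, c}, ∀ i ∈ ({a, b, c} : Finset α), i ∉ K → p (insert i K) ≤ p K + u i K)
    (hu : ∀ K ⊆ {a, b, c}, ∀ i ∈ ({a, b, c} : Finset α), ∀ j ∈ ({a, b, c} : Finset α), i ≠ j →
      i ∉ K → j ∉ K → u i (insert j K) ≤ u i K)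
    (hnonneg : ∀ K ⊆ {a, b, c}, ∀ i ∈ ({a, b, c} : Finset α), 0 ≤ u i K)
    (hkey : ∀ a' b' c' : α, [a', b', c'].Perm [a, b, c] →
      (p {a, b, c} - u b' {a', c'}) + (p {a, b, c} - u c' {a', b'})
        ≤ u a' {c'} + u c' ∅ + p {a'} + p {b'}) :
    ∃ g, IsFilling {a, b, c} p u g := by
  have hba := hab.symm
  have hca := hac.symm
  have hcb := hbc.symm
  have hsab : ({a, b} : Finset α) ⊆ {a, b, c} := by clear * -; grind
  have hsac : ({a, c} : Finset α) ⊆ {a, b, c} := by clear * -; grind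
  have hsbc : ({b, c} : Finset α) ⊆ {a, b, c} := by clear * -; grind
  have na := hnonneg {b, c} hsbc a (by simp)
  have nb := hnonneg {a, c} hsac b (by simp)
  have nc := hnonneg {a, b} hsab c (by simp)
  have pa := hp ∅ (by simp) a (by simp) (by simp)
  have pb := hp ∅ (by simp) b (by simp) (by simp)
  have pc := hp ∅ (by simp) c (by simp) (by simp)
  have pab := hp {a} (by simp) b (by simp) (by simp [hba])
  have pac := hp {a} (by simp) c (by simp) (by simp [hca])
  have pba := hp {b} (by simp) a (by simp) (by simp [hab])
  have pbc := hp {b} (by simp) c (by simp) (by simp [hcb])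
  have pca := hp {c} (by simp) a (by simp) (by simp [hac])
  have pcb := hp {c} (by simp) b (by simp) (by simp [hbc])
  have pabc := hp {a, b} hsab c (by simp) (by simp [hca, hcb])
  have pacb := hp {a, c} hsac b (by simp) (by simp [hba, hbc])
  have pbca := hp {b, c} hsbc a (by simp) (by simp [hab, hac])
  have ua_b := hu ∅ (by simp) a (by simp) b (by simp) hab (by simp) (by simp)
  have ua_c := hu ∅ (by simp) a (by simp) c (by simp) hac (by simp) (by simp)
  have ub_a := hu ∅ (by simp) b (by simp) a (by simp) hba (by simp) (by simp)
  have ub_c := hu ∅ (by simp) b (by simp) c (by simp) hbc (by simp) (by simp)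
  have uc_a := hu ∅ (by simp) c (by simp) a (by simp) hca (by simp) (by simp)
  have uc_b := hu ∅ (by simp) c (by simp) b (by simp) hcb (by simp) (by simp)
  have ua_bc := hu {c} (by simp) a (by simp) b (by simp) hab (by simp [hac]) (by simp [hbc])
  have ua_cb := hu {b} (by simp) a (by simp) c (by simp) hac (by simp [hab]) (by simp [hcb])
  have ub_ac := hu {c} (by simp) b (by simp) a (by simp) hba (by simp [hbc]) (by simp [hac])
  have ub_ca := hu {a} (by simp) b (by simp) c (by simp) hbc (by simp [hba]) (by simp [hca])
  have uc_ab := hu {b} (by simp) c (by simp) a (by simp) hca (by simp [hcb]) (by simp [hab])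
  have uc_ba := hu {a} (by simp) c (by simp) b (by simp) hcb (by simp [hca]) (by simp [hba])
  have k1 := hkey a b c (by clear * -; grind)
  have k2 := hkey a c b (by clear * -; grind)
  have k3 := hkey b a c (by clear * -; grind)
  have k4 := hkey b c a (by clear * -; grind)
  have k5 := hkey c a b (by clear * -; grind)
  have k6 := hkey c b a (by clear * -; grind)
  -- All sets are brought into alphabetical order.
  simp only [insert_empty_eq, Finset.pair_comm b a, Finset.pair_comm c a, Finset.pair_comm c b,
    Finset.insert_comm b a, Finset.insert_comm c a] at *
  clear hkey hp hu hnonneg hsab hsac hsbc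
  set T := p {a, b, c} with hT
  obtain ⟨gab, hgab⟩ : ∃ g, g = T - u c {a, b} := ⟨_, rfl⟩
  obtain ⟨gac, hgac⟩ : ∃ g, g = T - u b {a, c} := ⟨_, rfl⟩
  obtain ⟨gbc, hgbc⟩ : ∃ g, g = T - u a {b, c} := ⟨_, rfl⟩
  -- The values `va`, `vb`, `vc` at the singletons are bounded below by the increments up to the
  -- pairs, and above by `p` and by submodularity at the top of the cube. The three constraints
  -- linking them leave room for the value at `∅`.
  obtain ⟨va, vb, vc, hLa, hUa, hLb, hUb, hLc, hUc, hwa, hwb, hwc⟩ :=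
    exists_between_of_le_add (La := max (gab - u b {a}) (gac - u c {a}))
      (Lb := max (gab - u a {b}) (gbc - u c {b})) (Lc := max (gac - u a {c}) (gbc - u b {c}))
      (Ua := min (p {a}) (gab + gac - T)) (Ub := min (p {b}) (gab + gbc - T))
      (Uc := min (p {c}) (gac + gbc - T))
      (wa := u a ∅ - gbc) (wb := u b ∅ - gac) (wc := u c ∅ - gab)
      (by rw [max_le_iff, le_min_iff, le_min_iff]; refine ⟨⟨?_, ?_⟩, ?_, ?_⟩ <;> linarith)
      (by rw [max_le_iff, le_min_iff, le_min_iff]; refine ⟨⟨?_, ?_⟩, ?_, ?_⟩ <;> linarith)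
      (by rw [max_le_iff, le_min_iff, le_min_iff]; refine ⟨⟨?_, ?_⟩, ?_, ?_⟩ <;> linarith)
      (by linarith [le_max_left (gab - u b {a}) (gac - u c {a}),
        le_max_right (gab - u b {a}) (gac - u c {a})])
      (by linarith [le_max_left (gab - u a {b}) (gbc - u c {b}),
        le_max_right (gab - u a {b}) (gbc - u c {b})])
      (by linarith [le_max_left (gac - u a {c}) (gbc - u b {c}),
        le_max_right (gac - u a {c}) (gbc - u b {c})])
      (by
        rcases min_choice (p {b}) (gab + gbc - T) with h1 | h1 <;>
        rcases min_choice (p {c}) (gac + gbc - T) with h2 | h2 <;>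
        rw [h1, h2, max_le_iff] <;> constructor <;> linarith)
      (by
        rcases min_choice (p {a}) (gab + gac - T) with h1 | h1 <;>
        rcases min_choice (p {c}) (gac + gbc - T) with h2 | h2 <;>
        rw [h1, h2, max_le_iff] <;> constructor <;> linarith)
      (by
        rcases min_choice (p {a}) (gab + gac - T) with h1 | h1 <;>
        rcases min_choice (p {b}) (gab + gbc - T) with h2 | h2 <;>
        rw [h1, h2, max_le_iff] <;> constructor <;> linarith)
  rw [max_le_iff] at hLa hLb hLc
  rw [le_min_iff] at hUa hUb hUc
  -- The value at `∅` is the least one that the increments to the singletons permit.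
  obtain ⟨v, hv, hva, hvb, hvc⟩ : ∃ v, (v = va - u a ∅ ∨ v = vb - u b ∅ ∨ v = vc - u c ∅) ∧
      va ≤ v + u a ∅ ∧ vb ≤ v + u b ∅ ∧ vc ≤ v + u c ∅ := by
    refine ⟨max (va - u a ∅) (max (vb - u b ∅) (vc - u c ∅)), ?_, ?_, ?_, ?_⟩
    · clear * -
      grind
    · linarith [le_max_left (va - u a ∅) (max (vb - u b ∅) (vc - u c ∅))]
    · linarith [le_max_right (va - u a ∅) (max (vb - u b ∅) (vc - u c ∅)),
        le_max_left (vb - u b ∅) (vc - u c ∅)]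
    · linarith [le_max_right (va - u a ∅) (max (vb - u b ∅) (vc - u c ∅)),
        le_max_right (vb - u b ∅) (vc - u c ∅)]
  obtain ⟨hv0, hvab, hvac, hvbc⟩ :
      v ≤ p ∅ ∧ gab + v ≤ va + vb ∧ gac + v ≤ va + vc ∧ gbc + v ≤ vb + vc := by
    rcases hv with rfl | rfl | rfl <;> refine ⟨?_, ?_, ?_, ?_⟩ <;> linarith
  clear hv k1 k2 k3 k4 k5 k6 hwa hwb hwc
  refine ⟨fun K => if a ∈ K then if b ∈ K then if c ∈ K then T else gab else
    if c ∈ K then gac else va else if b ∈ K then if c ∈ K then gbc else vb else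
    if c ∈ K then vc else v, ?_, ?_, ?_, ?_, ?_⟩
  · simp [T]
  · intro K hK
    rcases subset_triple_cases hK with rfl | rfl | rfl | rfl | rfl | rfl | rfl | rfl <;>
      simp [hab, hac, hbc, hba, hca, hcb] <;> linarith
  · intro K hK i hi hiK
    simp only [Finset.mem_insert, Finset.mem_singleton] at hi
    rcases subset_triple_cases hK with rfl | rfl | rfl | rfl | rfl | rfl | rfl | rfl <;>
      rcases hi with rfl | rfl | rfl <;>
      first
      | (simp at hiK; done)
      | (simp [hab, hac, hbc, hba, hca, hcb]; linarith)
  · intro K hK i hi j hj hij hiK hjK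
    simp only [Finset.mem_insert, Finset.mem_singleton] at hi hj
    rcases subset_triple_cases hK with rfl | rfl | rfl | rfl | rfl | rfl | rfl | rfl <;>
      rcases hi with rfl | rfl | rfl <;>
      first
      | (simp at hiK; done)
      | (rcases hj with rfl | rfl | rfl <;>
        first
        | exact absurd rfl hij
        | (simp at hjK; done)
        | (simp [hab, hac, hbc, hba, hca, hcb]; linarith))
  · intro i hi
    simp only [Finset.mem_insert, Finset.mem_singleton] at hi
    rcases hi with rfl | rfl | rfl <;> simp [hab, hac, hbc, hba, hca, hcb] <;> linarith

end Cube

/-! ### The inequalities -/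

section Inequalities

variable {α : Type*} [DecidableEq α]

/-- Submodularity along a chain in the cube of `a, b, c` gives an inequality between the bounds `p`
and `u` that does not involve the filling. -/
theorem IsFilling.key {a b c : α} (hab : a ≠ b) (hac : a ≠ c) (hbc : b ≠ c) {p : Finset α → ℝ}
    {u : α → Finset α → ℝ} {g : Finset α → ℝ} (hg : IsFilling {a, b, c} p u g) :
    (p {a, b, c} - u b {a, c}) + (p {a, b, c} - u c {a, b})
      ≤ u a {c} + u c ∅ + p {a} + p {b} := by
  have h1 := hg.incr {a, c} (by grind) b (by simp) (by grind)
  have h2 := hg.incr {a, b} (by grind) c (by simp) (by grind)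
  have h3 := hg.incr {c} (by simp) a (by simp) (by grind)
  have h4 := hg.incr ∅ (by simp) c (by simp) (by simp)
  have h5 := hg.submodular ∅ (by simp) a (by simp) b (by simp) hab (by simp) (by simp)
  have h6 := hg.le {a} (by simp)
  have h7 := hg.le {b} (by simp)
  have e1 : ({b, a, c} : Finset α) = {a, b, c} := by grind
  have e2 : ({c, a, b} : Finset α) = {a, b, c} := by grind
  rw [e1, hg.top] at h1
  rw [e2, hg.top] at h2
  simp only [insert_empty_eq] at h4 h5
  linarith

theorem condInfo_singleton (f : Finset α → ℝ) (i j : α) (K : Finset α) :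
    condInfo f {i} {j} K = f (insert j K) + f (insert i K) - f (insert j (insert i K)) - f K := by
  have e : ({i} ∪ {j} ∪ K : Finset α) = insert j (insert i K) := by grind
  rw [condInfo, e, ← Finset.insert_eq, ← Finset.insert_eq]
  ring

/-- The bounds `jointBound` and `incrBound` turn the inequalities of the cube into those of
`AdhesiveIneq`: the choices of `s` and `t` come from the minima in `u b {a, c}` and `u c {a, b}`, the
two orders of `x`, `y` from the mixed choices in `u a {c}` and `u c ∅`. The unmixed choices follow
from the polymatroid inequalities alone. -/
theorem adhesiveIneq_and_iff {a b c x y : α} (hab : a ≠ b)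
    (hx : x ∉ ({a, b, c} : Finset α)) (hy : y ∉ ({a, b, c} : Finset α)) {fx fy : Finset α → ℝ}
    (hfx : IsPolymatroidOn ({a, b, c} ∪ {x}) fx) (hfy : IsPolymatroidOn ({a, b, c} ∪ {y}) fy)
    (hcommon : ∀ A, A ⊆ ({a, b, c} : Finset α) → fx A = fy A) :
    AdhesiveIneq fx fy a b c x y ∧ AdhesiveIneq fy fx a b c y x ↔
      (jointBound fx fy x y {a, b, c} - incrBound fx fy x y b {a, c})
        + (jointBound fx fy x y {a, b, c} - incrBound fx fy x y c {a, b})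
      ≤ incrBound fx fy x y a {c} + incrBound fx fy x y c ∅
        + jointBound fx fy x y {a} + jointBound fx fy x y {b} := by
  have c0 := hcommon ∅ (by simp)
  have ca := hcommon {a} (by simp)
  have cb := hcommon {b} (by simp)
  have cc := hcommon {c} (by simp)
  have cab := hcommon {a, b} (by grind)
  have cac := hcommon {a, c} (by grind)
  have cabc := hcommon {a, b, c} subset_rfl
  have x0 := hfx.map_empty
  have y0 := hfy.map_empty
  have e1 : ({b, a, c} : Finset α) = {a, b, c} := by grind
  have e2 : ({c, a, b} : Finset α) = {a, b, c} := by grind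
  have e3 : ({b, a} : Finset α) = {a, b} := Finset.pair_comm _ _
  have e4 : ({c, a} : Finset α) = {a, c} := Finset.pair_comm _ _
  have e5 : ({b, x, a} : Finset α) = {x, a, b} := by grind
  have e6 : ({b, y, a} : Finset α) = {y, a, b} := by grind
  -- The polymatroid inequalities needed for the unmixed choices.
  have px1 := hfx.submodular_adjoin hx (K := {a}) (i := c) (by simp) (by simp)
  have px2 := hfx.submodular_adjoin hx (K := {b}) (i := a) (by simp) (by simp)
  have px3 := hfx.submodular_insert_adjoin hx (K := ∅) (i := a) (j := b) (by simp) (by simp)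
    (by simp) hab (by simp)
  have px4 := hfx.submodular_adjoin hx (K := {a, b}) (i := c) (by grind) (by simp)
  have px5 := hfx.submodular_adjoin hx (K := {a, c}) (i := b) (by grind) (by simp)
  have py1 := hfy.submodular_adjoin hy (K := {a}) (i := c) (by simp) (by simp)
  have py2 := hfy.submodular_adjoin hy (K := {b}) (i := a) (by simp) (by simp)
  have py3 := hfy.submodular_insert_adjoin hy (K := ∅) (i := a) (j := b) (by simp) (by simp)
    (by simp) hab (by simp)
  have py4 := hfy.submodular_adjoin hy (K := {a, b}) (i := c) (by grind) (by simp)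
  have py5 := hfy.submodular_adjoin hy (K := {a, c}) (i := b) (by grind) (by simp)
  simp only [insert_empty_eq, e1, e2, e4] at px1 px2 px3 px4 px5 py1 py2 py3 py4 py5
  simp only [AdhesiveIneq, mutInfo, Set.mem_insert_iff, Set.mem_singleton_iff, forall_eq_or_imp,
    forall_eq, ge_iff_le, condInfo_singleton, jointBound, incrBound, insert_empty_eq, e1, e2, e3, e5,
    e6, Finset.pair_comm a x, Finset.pair_comm a y, Finset.pair_comm b x, Finset.pair_comm b y]
  constructor
  · rintro ⟨⟨⟨h1, h2⟩, h3, h4⟩, ⟨h5, h6⟩, h7, h8⟩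
    rcases min_choice (fx {x, a, b, c} - fx {x, a, c})
      (fy {y, a, b, c} - fy {y, a, c}) with h | h <;>
    rcases min_choice (fx {x, a, b, c} - fx {x, a, b})
      (fy {y, a, b, c} - fy {y, a, b}) with h' | h' <;>
    rcases min_choice (fx {x, a, c} - fx {x, c}) (fy {y, a, c} - fy {y, c}) with k | k <;>
    rcases min_choice (fx {x, c} - fx {x}) (fy {y, c} - fy {y}) with k' | k' <;>
    rw [h, h', k, k'] <;> linarith
  · intro H
    have b1 := min_le_left (fx {x, a, b, c} - fx {x, a, c}) (fy {y, a, b, c} - fy {y, a, c})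
    have b2 := min_le_right (fx {x, a, b, c} - fx {x, a, c}) (fy {y, a, b, c} - fy {y, a, c})
    have b3 := min_le_left (fx {x, a, b, c} - fx {x, a, b}) (fy {y, a, b, c} - fy {y, a, b})
    have b4 := min_le_right (fx {x, a, b, c} - fx {x, a, b}) (fy {y, a, b, c} - fy {y, a, b})
    have b5 := min_le_left (fx {x, a, c} - fx {x, c}) (fy {y, a, c} - fy {y, c})
    have b6 := min_le_right (fx {x, a, c} - fx {x, c}) (fy {y, a, c} - fy {y, c})
    have b7 := min_le_left (fx {x, c} - fx {x}) (fy {y, c} - fy {y})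
    have b8 := min_le_right (fx {x, c} - fx {x}) (fy {y, c} - fy {y})
    refine ⟨⟨⟨?_, ?_⟩, ?_, ?_⟩, ⟨?_, ?_⟩, ?_, ?_⟩ <;> linarith

theorem jointBound_insert_le {M : Finset α} {x y : α} {fx fy : Finset α → ℝ} (hxM : x ∉ M)
    (hyM : y ∉ M) (hfx : IsPolymatroidOn (M ∪ {x}) fx) (hfy : IsPolymatroidOn (M ∪ {y}) fy)
    (hcommon : ∀ A, A ⊆ M → fx A = fy A) {K : Finset α} (hK : K ⊆ M) {i : α} (hi : i ∈ M) :
    jointBound fx fy x y (insert i K) ≤ jointBound fx fy x y K + incrBound fx fy x y i K := by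
  have h1 := hfx.submodular_adjoin hxM hK hi
  have h2 := hfy.submodular_adjoin hyM hK hi
  have h3 := hcommon K hK
  have h4 := hcommon (insert i K) (Finset.insert_subset hi hK)
  rw [← sub_le_iff_le_add', incrBound, le_min_iff]
  simp only [jointBound]
  constructor <;> linarith

theorem incrBound_insert_le {M : Finset α} {x y : α} {fx fy : Finset α → ℝ} (hxM : x ∉ M)
    (hyM : y ∉ M) (hfx : IsPolymatroidOn (M ∪ {x}) fx) (hfy : IsPolymatroidOn (M ∪ {y}) fy)
    {K : Finset α} (hK : K ⊆ M) {i j : α} (hi : i ∈ M) (hj : j ∈ M) (hij : i ≠ j) (hiK : i ∉ K) :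
    incrBound fx fy x y i (insert j K) ≤ incrBound fx fy x y i K := by
  have h1 := hfx.submodular_insert_adjoin hxM hK hi hj hij hiK
  have h2 := hfy.submodular_insert_adjoin hyM hK hi hj hij hiK
  exact min_le_min (by linarith) (by linarith)

theorem incrBound_nonneg {M : Finset α} {x y : α} {fx fy : Finset α → ℝ}
    (hfx : IsPolymatroidOn (M ∪ {x}) fx) (hfy : IsPolymatroidOn (M ∪ {y}) fy)
    {K : Finset α} (hK : K ⊆ M) {i : α} (hi : i ∈ M) : 0 ≤ incrBound fx fy x y i K := by
  refine le_min (sub_nonneg.2 (hfx.mono _ _ ?_ ?_)) (sub_nonneg.2 (hfy.mono _ _ ?_ ?_)) <;> grind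

end Inequalities

theorem mainTheorem2 {α : Type*} [DecidableEq α] (a b c x y : α)
    (hdistinct : [a, b, c, x, y].Nodup) (fx fy : Finset α → ℝ)
    (hfx : IsPolymatroidOn ({a, b, c} ∪ {x}) fx)
    (hfy : IsPolymatroidOn ({a, b, c} ∪ {y}) fy)
    (hcommon : ∀ A, A ⊆ ({a, b, c} : Finset α) → fx A = fy A) :
    Adhesive {a, b, c} {x} {y} fx fy ↔
      ∀ a' b' c' : α, [a', b', c'].Perm [a, b, c] →
        AdhesiveIneq fx fy a' b' c' x y ∧ AdhesiveIneq fy fx a' b' c' y x := by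
  have hx : x ∉ ({a, b, c} : Finset α) := by grind
  have hy : y ∉ ({a, b, c} : Finset α) := by grind
  have hxy : x ≠ y := by grind
  have hM : ∀ a' b' c' : α, [a', b', c'].Perm [a, b, c] →
      ({a, b, c} : Finset α) = {a', b', c'} ∧ a' ≠ b' ∧ a' ≠ c' ∧ b' ≠ c' := by
    intro a' b' c' h
    have hn : [a', b', c'].Nodup := h.nodup_iff.2 (by grind)
    refine ⟨?_, by grind, by grind, by grind⟩
    ext i
    have := h.mem_iff (a := i)
    simpa using this.symm
  rw [adhesive_iff_exists_isFilling hx hy hxy hfx hfy hcommon]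
  constructor
  · rintro ⟨g, hg⟩ a' b' c' h
    obtain ⟨e, hab, hac, hbc⟩ := hM a' b' c' h
    rw [e] at hx hy hfx hfy hcommon hg
    exact (adhesiveIneq_and_iff hab hx hy hfx hfy hcommon).2 (hg.key hab hac hbc)
  · intro H
    refine exists_isFilling_of_key (by grind) (by grind) (by grind) ?_ ?_ ?_ ?_
    · intro K hK i hi _
      exact jointBound_insert_le hx hy hfx hfy hcommon hK hi
    · intro K hK i hi j hj hij hiK _
      exact incrBound_insert_le hx hy hfx hfy hK hi hj hij hiK
    · exact fun K hK i hi => incrBound_nonneg hfx hfy hK hi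
    · intro a' b' c' h
      obtain ⟨e, hab, -, -⟩ := hM a' b' c' h
      rw [e] at hx hy hfx hfy hcommon ⊢
      exact (adhesiveIneq_and_iff hab hx hy hfx hfy hcommon).1 (H a' b' c' h)
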